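/- Let $\Gamma$ be a finite simple graph in which exactly two distinct valencies occur, let $V_1,V_2$ be the two classes of vertices of equal valency, and let $\Gamma_1,\Gamma_2$ be the subgraphs induced on them. Suppose that * $\Gamma_1$ is complete; * calling the vertices in $V_1$ points and those in $V_2$ blocks, the edges between $V_1$ and $V_2$ form the incidence relation of a quasi-symmetric $2$-$(v,k,\lambda)$ design ($2\le k$, repeated blocks allowed) with $b$ blocks and block intersection sizes $x\neq y$; that is, there are $v$ points, every block is incident with $k$ points, any two distinct points are incident with exactly $\lambda$ common blocks, any two distinct blocks have either $x$ or $y$ common points, and both of these sizes occur (we do not assume $x<y$); * $\Gamma_2$ is the corresponding block graph: two distinct blocks are adjacent if and only if they have exactly $y$ common points. Put $$r=\lambda\frac{v-1}{k-1},\quad a=\frac{(r-1)k-x(b-1)}{y-x},\quad \rho_1=\frac{r-\lambda-k+x}{y-x},\quad \rho_2=\frac{x-k}{y-x},\quad d=a+\rho_1\rho_2,\quad c=d+\rho_1+\rho_2$$ (so that $r$ is the replication number of the design and $\Gamma_2$ is strongly regular with parameters $(b,a,c,d)$). The normalized Laplacian of $\Gamma$ is the matrix $\mathcal L$ indexed by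 the vertices, with $\mathcal L_{uu}=1$ if the valency $d_u$ of $u$ is nonzero, $\mathcal L_{uw}=-1/\sqrt{d_ud_w}$ if $u$ and $w$ are adjacent, and all other entries $0$. Let $\theta_1,\theta_2$ be real numbers, and let $$t=\frac{\theta_1\theta_2}{v(v-1+r)+b(k+a)}.$$ Then $\mathcal L$ has exactly three distinct eigenvalues, namely $0,\theta_1,\theta_2$, if and only if all of the following hold: $$\begin{array}{rcl} \frac{v-1}{v-1+r}+\frac{r}{k+a}&=&t(v-1+r)^2-(\theta_1-1)(\theta_2-1)(v-1+r),\\ \frac{v-2}{v-1+r}+\frac{\lambda}{k+a}&=&t(v-1+r)^2+2-\theta_1-\theta_2,\\ \frac{k}{v-1+r}+\frac{a}{k+a}&=&t(k+a)^2-(\theta_1-1)(\theta_2-1)(k+a),\\ \frac{x}{v-1+r}+\frac{d}{k+a}&=&t(k+a)^2,\\ \frac{y}{v-1+r}+\frac{c}{k+a}&=&t(k+a)^2+2-\theta_1-\theta_2,\\ \frac{k}{v-1+r}+\frac{\lambda k-xr}{(y-x)(k+a)}&=&t(v-1+r)(k+a),\\ \frac{k-1}{v-1+r}+\frac{(\lambda-1)(k-1)-(x-1)(r-1)}{(y-x)(k+a)}&=&t(v-1+r)(k+a)+2-\theta_1-\theta_2.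 \end{array}$$ -/

import Mathlib

/-- The normalized Laplacian matrix of a finite simple graph. -/
noncomputable def SimpleGraph.normalizedLaplacian {V : Type*} [Fintype V] [DecidableEq V]
    (G : SimpleGraph V) [DecidableRel G.Adj] : Matrix V V ℝ :=
  Matrix.of fun u w =>
    if u = w then (if G.degree u ≠ 0 then 1 else 0)
    else if G.Adj u w then -1 / Real.sqrt ((G.degree u : ℝ) * (G.degree w : ℝ))
    else 0

/-- The graph has exactly three distinct normalized Laplacian eigenvalues, namely
`0`, `θ₁` and `θ₂`. -/
def SimpleGraph.HasThreeNormalizedLaplacianEigenvalues {V : Type*} [Fintype V] [DecidableEq V]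
    (G : SimpleGraph V) [DecidableRel G.Adj] (θ₁ θ₂ : ℝ) : Prop :=
  θ₁ ≠ 0 ∧ θ₂ ≠ 0 ∧ θ₁ ≠ θ₂ ∧
    ∀ μ : ℝ, Module.End.HasEigenvalue (Matrix.toLin' G.normalizedLaplacian) μ ↔
      μ = 0 ∨ μ = θ₁ ∨ μ = θ₂

/-- The graph is biregular (exactly two distinct valencies occur), and `V₁`, `V₂` are the classes
of its partition according to valencies. -/
def SimpleGraph.IsBiregularWithValencyPartition {V : Type*} [Fintype V]
    (G : SimpleGraph V) [DecidableRel G.Adj] (V₁ V₂ : Finset V) : Prop :=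
  ∃ k₁ k₂ : ℕ, k₁ ≠ k₂ ∧ V₁.Nonempty ∧ V₂.Nonempty ∧
    (∀ u, u ∈ V₁ ↔ G.degree u = k₁) ∧
    (∀ u, u ∈ V₂ ↔ G.degree u = k₂) ∧
    ∀ u, u ∈ V₁ ∨ u ∈ V₂

/-- `I` is the incidence relation of a `2`-`(v,k,l)` design with points `P` and `b` blocks `B`.
Distinct blocks may be incident with the same points (repeated blocks). -/
structure IsTwoDesign {P B : Type*} [Fintype P] [Fintype B]
    (I : P → B → Prop) [∀ p β, Decidable (I p β)] (v b k l : ℕ) : Prop where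
  card_points : Fintype.card P = v
  card_blocks : Fintype.card B = b
  two_le_k : 2 ≤ k
  k_le_v : k ≤ v
  l_pos : 0 < l
  block_size : ∀ β : B, (Finset.univ.filter fun p : P => I p β).card = k
  pair_count : ∀ p q : P, p ≠ q → (Finset.univ.filter fun β : B => I p β ∧ I q β).card = l

/-- The number of points incident with both of two blocks. -/
def blockIntersectionSize {P B : Type*} [Fintype P]
    (I : P → B → Prop) [∀ p β, Decidable (I p β)] (β γ : B) : ℕ :=
  (Finset.univ.filter fun p : P => I p β ∧ I p γ).card

/-- `I` is the incidence relation of a quasi-symmetric `2`-`(v,k,l)` design with `b` blocks: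
exactly two sizes `x ≠ y` (in either order) occur as intersection sizes of distinct blocks. -/
structure IsQuasiSymmetricDesign {P B : Type*} [Fintype P] [Fintype B]
    (I : P → B → Prop) [∀ p β, Decidable (I p β)] (v b k l x y : ℕ) : Prop
    extends IsTwoDesign I v b k l where
  x_ne_y : x ≠ y
  intersection : ∀ β γ : B, β ≠ γ →
    blockIntersectionSize I β γ = x ∨ blockIntersectionSize I β γ = y
  exists_x : ∃ β γ : B, β ≠ γ ∧ blockIntersectionSize I β γ = x
  exists_y : ∃ β γ : B, β ≠ γ ∧ blockIntersectionSize I β γ = y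

/-- The block graph: distinct blocks are adjacent when they intersect in `y` points. -/
def blockGraph {P B : Type*} [Fintype P]
    (I : P → B → Prop) [∀ p β, Decidable (I p β)] (y : ℕ) : SimpleGraph B where
  Adj β γ := β ≠ γ ∧ blockIntersectionSize I β γ = y
  symm := ⟨fun β γ h => ⟨h.1.symm, by
    have h2 := h.2
    unfold blockIntersectionSize at h2 ⊢
    simpa only [and_comm] using h2⟩⟩
  loopless := ⟨fun _ h => h.1 rfl⟩

/-- The relation between two sets of vertices given by the edges between them. -/
def SimpleGraph.incidenceBetween {V : Type*} (G : SimpleGraph V) (V₁ V₂ : Finset V) :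
    V₁ → V₂ → Prop :=
  fun p β => G.Adj p.1 β.1

instance {V : Type*} (G : SimpleGraph V) [DecidableRel G.Adj] (V₁ V₂ : Finset V) (p : V₁)
    (β : V₂) : Decidable (G.incidenceBetween V₁ V₂ p β) :=
  inferInstanceAs (Decidable (G.Adj p.1 β.1))

open Matrix

/-! All valencies are positive and the graph is connected, so the kernel of the normalized Laplacian
`L` is spanned by the vector `s` of square roots of the valencies. As `L` is symmetric, having
eigenvalues 0, θ₁, θ₂ forces the columns of (L - θ₁)(L - θ₂) into that kernel, and multiplying by
`s` identifies this matrix as ssᵀ times θ₁θ₂ over the sum of the valencies. Conversely, this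
rank-one identity confines the spectrum to {0, θ₁, θ₂}; since the graph is not complete, one nonzero
eigenvalue is not enough, so θ₁ and θ₂ both occur.

Scaling the (u, w) entry by √(d_u d_w) gives an equation for the sum of 1/d_z over the common
neighbours z of u and w (`hasThreeNormalizedLaplacianEigenvalues_iff`). With N the incidence matrix
and A the block graph matrix, the adjacency matrix has blocks J - I, N, Nᵀ, A. The products NNᵀ,
NᵀN, NA and A² are combinations of I, J, N and A, so the equation depends only on the type of the
pair: equal or distinct points, equal, non-adjacent or adjacent blocks, non-incident or incident
point and block. All seven types occur, and they give the seven equations. -/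

/-- A polynomial vanishing at all eigenvalues of a real symmetric matrix annihilates the matrix. -/
theorem Matrix.IsHermitian.aeval_eq_zero_of_forall_hasEigenvalue {n : Type*} [Fintype n]
    [DecidableEq n] {A : Matrix n n ℝ} (hA : A.IsHermitian) (p : Polynomial ℝ)
    (hp : ∀ μ, Module.End.HasEigenvalue (toLin' A) μ → p.eval μ = 0) :
    Polynomial.aeval A p = 0 := by
  have hlin : Polynomial.aeval (toLin' A) p = 0 := by
    -- It suffices to check on an eigenbasis, carried over from Euclidean space to plain functions.
    refine (hA.eigenvectorBasis.toBasis.map (WithLp.linearEquiv 2 ℝ (n → ℝ))).ext fun j => ?_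
    have hj : Module.End.HasEigenvector (toLin' A) (hA.eigenvalues j)
        (WithLp.linearEquiv 2 ℝ (n → ℝ) (hA.eigenvectorBasis j)) := by
      refine Module.End.hasEigenvector_iff.2 ⟨Module.End.mem_eigenspace_iff.2 ?_, ?_⟩
      · exact hA.mulVec_eigenvectorBasis j
      · rw [Ne, LinearEquiv.map_eq_zero_iff]
        exact hA.eigenvectorBasis.orthonormal.ne_zero j
    simp only [Module.Basis.map_apply, OrthonormalBasis.coe_toBasis, LinearMap.zero_apply]
    rw [Module.End.aeval_apply_of_hasEigenvector hj,
      hp _ (Module.End.hasEigenvalue_of_hasEigenvector hj), zero_smul]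
  have h := Polynomial.aeval_algHom_apply (toLinAlgEquiv' (R := ℝ) (n := n)).toAlgHom A p
  refine (toLinAlgEquiv' (R := ℝ) (n := n)).injective ?_
  rw [map_zero]
  exact h.symm.trans hlin

/-! ### Kernel and spectrum of the normalized Laplacian -/

namespace SimpleGraph

variable {V : Type*} [Fintype V] [DecidableEq V] (G : SimpleGraph V) [DecidableRel G.Adj]

theorem normalizedLaplacian_apply (hdeg : ∀ u, 0 < G.degree u) (u w : V) :
    G.normalizedLaplacian u w =
      (1 : Matrix V V ℝ) u w - G.adjMatrix ℝ u w / (√(G.degree u : ℝ) * √(G.degree w : ℝ)) := by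
  have := (hdeg u).ne'
  by_cases h : u = w
  · subst h
    simp [normalizedLaplacian, this]
  · by_cases h' : G.Adj u w <;>
      simp [normalizedLaplacian, h, h', neg_div]

theorem isHermitian_normalizedLaplacian (hdeg : ∀ u, 0 < G.degree u) :
    G.normalizedLaplacian.IsHermitian := by
  ext u w
  simp only [conjTranspose_apply, star_trivial, G.normalizedLaplacian_apply hdeg]
  rw [← (G.isSymm_adjMatrix (α := ℝ)).apply u w, ← isSymm_one.apply u w, mul_comm]

/-- This is D^{1/2} L D^{1/2} = D - A applied to `h`; it carries the known kernel of the ordinary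
Laplacian over to `L`. -/
theorem sqrt_degree_mul_normalizedLaplacian_mulVec (hdeg : ∀ u, 0 < G.degree u) (h : V → ℝ)
    (u : V) :
    √(G.degree u : ℝ) * (G.normalizedLaplacian *ᵥ fun w => √(G.degree w : ℝ) * h w) u =
      (G.lapMatrix ℝ *ᵥ h) u := by
  have hs : ∀ w, √(G.degree w : ℝ) ≠ 0 := fun w =>
    (Real.sqrt_pos.2 (Nat.cast_pos.2 (hdeg w))).ne'
  simp only [mulVec, dotProduct, Finset.mul_sum]
  refine Finset.sum_congr rfl fun w _ => ?_
  rw [G.normalizedLaplacian_apply hdeg, lapMatrix, Matrix.sub_apply, degMatrix, diagonal_apply,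
    Matrix.one_apply]
  have := hs u
  have := hs w
  split_ifs with huw
  · subst huw
    have := Real.mul_self_sqrt (Nat.cast_nonneg (α := ℝ) (G.degree u))
    field_simp
    linear_combination h u * this
  · field_simp
    ring

theorem normalizedLaplacian_mulVec_sqrt_degree (hdeg : ∀ u, 0 < G.degree u) :
    (G.normalizedLaplacian *ᵥ fun w => √(G.degree w : ℝ)) = 0 := by
  ext u
  have h := G.sqrt_degree_mul_normalizedLaplacian_mulVec hdeg (fun _ => 1) u
  rw [lapMatrix_mulVec_const_eq_zero] at h
  simpa [(hdeg u).ne'] using h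

/-- The kernel of the normalized Laplacian of a connected graph is spanned by the vector of square
roots of the degrees. -/
theorem exists_eq_mul_sqrt_degree_of_normalizedLaplacian_mulVec_eq_zero
    (hdeg : ∀ u, 0 < G.degree u) (hconn : G.Connected) {z : V → ℝ}
    (hz : G.normalizedLaplacian *ᵥ z = 0) : ∃ g : ℝ, ∀ u, z u = g * √(G.degree u : ℝ) := by
  have hs : ∀ w, √(G.degree w : ℝ) ≠ 0 := fun w =>
    (Real.sqrt_pos.2 (Nat.cast_pos.2 (hdeg w))).ne'
  have hz' : z = fun w => √(G.degree w : ℝ) * (z w / √(G.degree w : ℝ)) := by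
    ext w
    rw [mul_div_cancel₀ _ (hs w)]
  have h0 : G.lapMatrix ℝ *ᵥ (fun w => z w / √(G.degree w : ℝ)) = 0 := by
    ext u
    rw [← G.sqrt_degree_mul_normalizedLaplacian_mulVec hdeg, ← hz', hz]
    simp
  rw [lapMatrix_mulVec_eq_zero_iff_forall_reachable] at h0
  obtain ⟨o⟩ := hconn.nonempty
  refine ⟨z o / √(G.degree o : ℝ), fun u => ?_⟩
  rw [h0 o u (hconn.preconnected o u), div_mul_cancel₀ _ (hs u)]

/-- The columns of a matrix annihilated by the normalized Laplacian of a connected graph are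
multiples of the vector of square roots of the degrees. -/
theorem exists_eq_mul_sqrt_degree_of_normalizedLaplacian_mul_eq_zero
    (hdeg : ∀ u, 0 < G.degree u) (hconn : G.Connected) {M : Matrix V V ℝ}
    (hM : G.normalizedLaplacian * M = 0) :
    ∃ g : V → ℝ, ∀ u w, M u w = g w * √(G.degree u : ℝ) := by
  have h : ∀ w, ∃ g : ℝ, ∀ u, M u w = g * √(G.degree u : ℝ) := fun w =>
    G.exists_eq_mul_sqrt_degree_of_normalizedLaplacian_mulVec_eq_zero hdeg hconn
      (z := fun u => M u w) (by ext u; exact congrFun (congrFun hM u) w)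
  choose g hg using h
  exact ⟨g, fun u w => hg w u⟩

/-- A connected graph that is not complete has two distinct nonzero normalized Laplacian
eigenvalues. -/
theorem exists_hasEigenvalue_normalizedLaplacian_ne (hdeg : ∀ u, 0 < G.degree u)
    (hconn : G.Connected) (hnc : ∃ u w, u ≠ w ∧ ¬ G.Adj u w) (θ : ℝ) :
    ∃ μ, Module.End.HasEigenvalue (toLin' G.normalizedLaplacian) μ ∧ μ ≠ 0 ∧ μ ≠ θ := by
  -- Otherwise L(L - θ) = 0, so column `w` of L - θ is a multiple of √d. Its entry at the
  -- non-neighbour `u` is 0, so the whole column vanishes, contradicting the nonzero entry at a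
  -- neighbour of `w`.
  by_contra! hcon
  have hpol := (G.isHermitian_normalizedLaplacian hdeg).aeval_eq_zero_of_forall_hasEigenvalue
    (Polynomial.X * (Polynomial.X - Polynomial.C θ)) (fun μ hμ => by
      by_cases h : μ = 0
      · simp [h]
      · simp [hcon μ hμ h])
  simp only [map_mul, map_sub, Polynomial.aeval_X, Polynomial.aeval_C] at hpol
  obtain ⟨g, hg⟩ := G.exists_eq_mul_sqrt_degree_of_normalizedLaplacian_mul_eq_zero hdeg hconn hpol
  obtain ⟨u, w, huw, hadj⟩ := hnc
  have hs : ∀ w, √(G.degree w : ℝ) ≠ 0 := fun w =>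
    (Real.sqrt_pos.2 (Nat.cast_pos.2 (hdeg w))).ne'
  have hgw : g w = 0 := by
    have h := hg u w
    simp [G.normalizedLaplacian_apply hdeg, Matrix.algebraMap_matrix_apply,
      huw, hadj] at h
    exact h.resolve_right (hdeg u).ne'
  obtain ⟨z, hz⟩ := (G.degree_pos_iff_exists_adj w).1 (hdeg w)
  have h := hg z w
  simp [G.normalizedLaplacian_apply hdeg, Matrix.algebraMap_matrix_apply,
      hz.symm, hz.ne', hgw, (hdeg z).ne', (hdeg w).ne'] at h

theorem hasThreeNormalizedLaplacianEigenvalues_iff_mul_eq (hdeg : ∀ u, 0 < G.degree u)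
    (hconn : G.Connected) (hnc : ∃ u w, u ≠ w ∧ ¬ G.Adj u w) (θ₁ θ₂ : ℝ) :
    G.HasThreeNormalizedLaplacianEigenvalues θ₁ θ₂ ↔
      (G.normalizedLaplacian - algebraMap ℝ _ θ₁) * (G.normalizedLaplacian - algebraMap ℝ _ θ₂) =
        (θ₁ * θ₂ / ∑ u, (G.degree u : ℝ)) •
          vecMulVec (fun u => √(G.degree u : ℝ)) (fun u => √(G.degree u : ℝ)) := by
  set L := G.normalizedLaplacian with hL
  set s : V → ℝ := fun u => √(G.degree u : ℝ) with hs
  obtain ⟨o⟩ := hconn.nonempty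
  have hso : s o ≠ 0 := (Real.sqrt_pos.2 (Nat.cast_pos.2 (hdeg o))).ne'
  have hsum : (∑ u, (G.degree u : ℝ)) ≠ 0 :=
    (Finset.sum_pos (fun u _ => Nat.cast_pos.2 (hdeg u)) ⟨o, Finset.mem_univ o⟩).ne'
  have hLs : L *ᵥ s = 0 := G.normalizedLaplacian_mulVec_sqrt_degree hdeg
  have hherm := G.isHermitian_normalizedLaplacian hdeg
  have hsL : s ᵥ* L = 0 := by
    rw [← mulVec_transpose, ← conjTranspose_eq_transpose_of_trivial, hherm.eq, hLs]
  have hss : s ⬝ᵥ s = ∑ u, (G.degree u : ℝ) := by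
    simp [hs, dotProduct]
  have halg : ∀ (θ : ℝ) (z : V → ℝ), algebraMap ℝ (Matrix V V ℝ) θ *ᵥ z = θ • z := fun θ z => by
    rw [Algebra.algebraMap_eq_smul_one, smul_mulVec, one_mulVec]
  constructor
  · rintro ⟨-, -, -, h⟩
    have hpol := hherm.aeval_eq_zero_of_forall_hasEigenvalue
      (Polynomial.X * ((Polynomial.X - Polynomial.C θ₁) * (Polynomial.X - Polynomial.C θ₂)))
      (fun μ hμ => by
        rcases (h μ).1 hμ with rfl | rfl | rfl <;> simp)
    simp only [map_mul, map_sub, Polynomial.aeval_X, Polynomial.aeval_C] at hpol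
    obtain ⟨g, hg⟩ :=
      G.exists_eq_mul_sqrt_degree_of_normalizedLaplacian_mul_eq_zero hdeg hconn hpol
    rw [← hL] at hg
    -- Since sᵀL = 0, multiplying by sᵀ on the left determines the unknown column coefficients `g`.
    have hleft : s ᵥ* ((L - algebraMap ℝ _ θ₁) * (L - algebraMap ℝ _ θ₂)) = (θ₁ * θ₂) • s := by
      have hθ : ∀ θ : ℝ, s ᵥ* (L - algebraMap ℝ _ θ) = (-θ) • s := fun θ => by
        rw [vecMul_sub, hsL, Algebra.algebraMap_eq_smul_one, vecMul_smul, vecMul_one, zero_sub,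
          neg_smul]
      rw [← vecMul_vecMul, hθ, smul_vecMul, hθ, smul_smul, neg_mul_neg]
    ext u w
    have hw := congrFun hleft w
    simp only [vecMul, dotProduct, hg] at hw
    have hw' : g w * ∑ u, (G.degree u : ℝ) = θ₁ * θ₂ * s w := by
      rw [← hss, dotProduct, Finset.mul_sum, ← smul_eq_mul (θ₁ * θ₂), ← Pi.smul_apply, ← hw]
      exact Finset.sum_congr rfl fun i _ => by simp only [hs]; ring
    rw [hg, Matrix.smul_apply, vecMulVec_apply, smul_eq_mul]
    field_simp
    linear_combination s u * hw'
  · intro hM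
    have hsub : ∀ μ, Module.End.HasEigenvalue (toLin' L) μ → μ = 0 ∨ μ = θ₁ ∨ μ = θ₂ := by
      intro μ hμ
      by_cases hμ0 : μ = 0
      · exact Or.inl hμ0
      obtain ⟨z, hz⟩ := hμ.exists_hasEigenvector
      have hLz : L *ᵥ z = μ • z := hz.apply_eq_smul
      -- An eigenvector for a nonzero eigenvalue is orthogonal to `s`, so the rank-one right-hand
      -- side kills it.
      have hsz : s ⬝ᵥ z = 0 := by
        have h1 : s ⬝ᵥ (L *ᵥ z) = 0 := by rw [dotProduct_mulVec, hsL, zero_dotProduct]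
        rw [hLz, dotProduct_smul, smul_eq_mul] at h1
        exact (mul_eq_zero.1 h1).resolve_left hμ0
      have h2 := congrArg (· *ᵥ z) hM
      simp only [← mulVec_mulVec, sub_mulVec, hLz, halg, ← sub_smul, mulVec_smul, smul_smul,
        smul_mulVec, vecMulVec_mulVec, hsz] at h2
      have h3 : ((μ - θ₂) * (μ - θ₁)) • z = 0 := by rw [h2]; simp
      rcases mul_eq_zero.1 ((smul_eq_zero.1 h3).resolve_right hz.2) with h | h
      · exact Or.inr (Or.inr (sub_eq_zero.1 h))
      · exact Or.inr (Or.inl (sub_eq_zero.1 h))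
    -- A nonzero eigenvalue other than θ₂ can only be θ₁, and vice versa; this also shows that θ₁
    -- and θ₂ are nonzero and distinct.
    have hne := G.exists_hasEigenvalue_normalizedLaplacian_ne hdeg hconn hnc
    obtain ⟨μ₁, h₁, h₁0, h₁'⟩ := hne θ₂
    obtain ⟨μ₂, h₂, h₂0, h₂'⟩ := hne θ₁
    have e₁ : μ₁ = θ₁ := ((hsub μ₁ h₁).resolve_left h₁0).resolve_right h₁'
    have e₂ : μ₂ = θ₂ := (((hsub μ₂ h₂).resolve_left h₂0).resolve_left h₂')
    subst e₁ e₂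
    refine ⟨h₁0, h₂0, h₁', fun μ => ⟨hsub μ, ?_⟩⟩
    rintro (rfl | rfl | rfl)
    · refine Module.End.hasEigenvalue_of_hasEigenvector (x := s)
        (Module.End.hasEigenvector_iff.2 ⟨Module.End.mem_eigenspace_iff.2 ?_, ?_⟩)
      · rw [zero_smul]; exact hLs
      · exact fun h => hso (congrFun h o)
    · exact h₁
    · exact h₂

/-- A connected graph that is not complete has exactly the normalized Laplacian eigenvalues
`0, θ₁, θ₂` if and only if its weighted numbers of common neighbours satisfy a system of
equations. -/
theorem hasThreeNormalizedLaplacianEigenvalues_iff (hdeg : ∀ u, 0 < G.degree u)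
    (hconn : G.Connected) (hnc : ∃ u w, u ≠ w ∧ ¬ G.Adj u w) (θ₁ θ₂ : ℝ) :
    G.HasThreeNormalizedLaplacianEigenvalues θ₁ θ₂ ↔
      ∀ u w, ∑ z, G.adjMatrix ℝ u z * G.adjMatrix ℝ z w / (G.degree z : ℝ) =
        θ₁ * θ₂ / (∑ u, (G.degree u : ℝ)) * G.degree u * G.degree w
          - (θ₁ - 1) * (θ₂ - 1) * (if u = w then (G.degree u : ℝ) else 0)
          + (2 - θ₁ - θ₂) * G.adjMatrix ℝ u w := by
  rw [G.hasThreeNormalizedLaplacianEigenvalues_iff_mul_eq hdeg hconn hnc, ← Matrix.ext_iff]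
  refine forall₂_congr fun u w => ?_
  have hs : ∀ w, √(G.degree w : ℝ) ≠ 0 := fun w =>
    (Real.sqrt_pos.2 (Nat.cast_pos.2 (hdeg w))).ne'
  have hsq : ∀ w, √(G.degree w : ℝ) * √(G.degree w : ℝ) = G.degree w := fun w =>
    Real.mul_self_sqrt (Nat.cast_nonneg _)
  -- With `N` the normalized adjacency matrix, L = 1 - N, and the product becomes a quadratic in
  -- `N`.
  let N : Matrix V V ℝ :=
    of fun u w => G.adjMatrix ℝ u w / (√(G.degree u : ℝ) * √(G.degree w : ℝ))
  have hLN : G.normalizedLaplacian = 1 - N := by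
    ext u w
    rw [G.normalizedLaplacian_apply hdeg]
    rfl
  have hexp : (G.normalizedLaplacian - algebraMap ℝ _ θ₁) *
      (G.normalizedLaplacian - algebraMap ℝ _ θ₂) =
      N * N - (2 - θ₁ - θ₂) • N + ((θ₁ - 1) * (θ₂ - 1)) • (1 : Matrix V V ℝ) := by
    rw [hLN, Algebra.algebraMap_eq_smul_one, Algebra.algebraMap_eq_smul_one]
    simp only [sub_mul, mul_sub, one_mul, mul_one, smul_mul_assoc, mul_smul_comm]
    module
  have hNN : (N * N) u w = (∑ z, G.adjMatrix ℝ u z * G.adjMatrix ℝ z w / (G.degree z : ℝ)) /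
      (√(G.degree u : ℝ) * √(G.degree w : ℝ)) := by
    rw [mul_apply, Finset.sum_div]
    refine Finset.sum_congr rfl fun z _ => ?_
    simp only [N, of_apply]
    have hz := hs z
    have hqz := hsq z
    generalize √(G.degree z : ℝ) = q at hz hqz ⊢
    have := hs u
    have := hs w
    rw [← hqz]
    field_simp
  rw [hexp, Matrix.add_apply, Matrix.sub_apply, hNN, Matrix.smul_apply, Matrix.smul_apply, Matrix.smul_apply, vecMulVec_apply,
    Matrix.one_apply]
  simp only [N, of_apply, smul_eq_mul]
  set S := ∑ z, G.adjMatrix ℝ u z * G.adjMatrix ℝ z w / (G.degree z : ℝ)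
  set T := θ₁ * θ₂ / ∑ u, (G.degree u : ℝ)
  have hu := hs u
  have hw := hs w
  have hone : (if u = w then (G.degree u : ℝ) else 0) =
      (if u = w then 1 else 0) * (√(G.degree u : ℝ) * √(G.degree w : ℝ)) := by
    split_ifs with h
    · subst h; rw [hsq, one_mul]
    · simp
  rw [hone, ← mul_right_inj' (mul_ne_zero hu hw) (b := _ + _)]
  rw [← sub_eq_zero, ← sub_eq_zero (a := S)]
  have e : √(G.degree u : ℝ) * √(G.degree w : ℝ) * (S / (√(G.degree u : ℝ) * √(G.degree w : ℝ)) -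
      (2 - θ₁ - θ₂) * (G.adjMatrix ℝ u w / (√(G.degree u : ℝ) * √(G.degree w : ℝ))) +
      (θ₁ - 1) * (θ₂ - 1) * (if u = w then 1 else 0)) = S - (2 - θ₁ - θ₂) * G.adjMatrix ℝ u w +
      (θ₁ - 1) * (θ₂ - 1) * ((if u = w then 1 else 0) *
        (√(G.degree u : ℝ) * √(G.degree w : ℝ))) := by
    field_simp
  rw [e]
  have e2 : √(G.degree u : ℝ) * √(G.degree w : ℝ) * (T * (√(G.degree u : ℝ) * √(G.degree w : ℝ))) =
      T * G.degree u * G.degree w := by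
    linear_combination T * (√(G.degree w : ℝ) * √(G.degree w : ℝ)) * hsq u + T * G.degree u * hsq w
  rw [e2]
  constructor <;> intro h <;> linear_combination h

end SimpleGraph

/-! ### Matrix identities for designs and their block graphs -/

section Design

variable {P B : Type*} (I : P → B → Prop) [∀ p β, Decidable (I p β)]

/-- The point-block incidence matrix. -/
def pointBlockMatrix : Matrix P B ℝ := of fun p β => if I p β then 1 else 0

/-- The adjacency matrix of the block graph. -/
def blockGraphMatrix [Fintype P] [DecidableEq B] (y : ℕ) : Matrix B B ℝ :=
  of fun β γ => if β ≠ γ ∧ blockIntersectionSize I β γ = y then 1 else 0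

theorem pointBlockMatrix_apply (p : P) (β : B) :
    pointBlockMatrix I p β = if I p β then 1 else 0 := rfl

theorem blockIntersectionSize_comm [Fintype P] (β γ : B) :
    blockIntersectionSize I β γ = blockIntersectionSize I γ β := by
  simp only [blockIntersectionSize, and_comm]

theorem blockGraphMatrix_transpose [Fintype P] [DecidableEq B] (y : ℕ) :
    (blockGraphMatrix I y)ᵀ = blockGraphMatrix I y := by
  ext β γ
  simp only [blockGraphMatrix, transpose_apply, of_apply, blockIntersectionSize_comm I γ β,
    ne_comm (a := γ)]

/-- The matrix all of whose entries are `1`. -/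
def onesMatrix (m n : Type*) : Matrix m n ℝ := of fun _ _ => 1

theorem onesMatrix_mul_onesMatrix (m n o : Type*) [Fintype n] :
    onesMatrix m n * onesMatrix n o = (Fintype.card n : ℝ) • onesMatrix m o := by
  ext
  simp [onesMatrix, mul_apply]

theorem onesMatrix_transpose (m n : Type*) : (onesMatrix m n)ᵀ = onesMatrix n m := rfl

theorem pointBlockMatrix_mul_self (p : P) (β : B) :
    pointBlockMatrix I p β * pointBlockMatrix I p β = pointBlockMatrix I p β := by
  simp [pointBlockMatrix_apply]

namespace IsTwoDesign

variable {I} [Fintype P] [Fintype B] {v b k l : ℕ}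

theorem sum_points (h : IsTwoDesign I v b k l) (β : B) : ∑ p, pointBlockMatrix I p β = k := by
  simp [pointBlockMatrix_apply, Finset.sum_boole, h.block_size]

theorem sum_blocks_mul (h : IsTwoDesign I v b k l) {p q : P} (hpq : p ≠ q) :
    ∑ β, pointBlockMatrix I p β * pointBlockMatrix I q β = l := by
  simp [pointBlockMatrix_apply, ← ite_and, Finset.sum_boole, ← h.pair_count p q hpq, and_comm]

/-- Double count the pairs (q, β) with `p` and `q` on β: the term q = p gives r and every other
point gives `l`, so kr = r + (v - 1)l. -/
theorem sum_blocks (h : IsTwoDesign I v b k l) (p : P) :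
    ∑ β, pointBlockMatrix I p β = (l : ℝ) * ((v : ℝ) - 1) / ((k : ℝ) - 1) := by
  classical
  have hk : (2 : ℝ) ≤ k := by exact_mod_cast h.two_le_k
  have h1 : ∑ q, ∑ β, pointBlockMatrix I p β * pointBlockMatrix I q β =
      k * ∑ β, pointBlockMatrix I p β := by
    rw [Finset.sum_comm, Finset.mul_sum]
    refine Finset.sum_congr rfl fun β _ => ?_
    rw [← Finset.mul_sum, h.sum_points, mul_comm]
  have hP : 1 ≤ v := h.card_points ▸ Fintype.card_pos_iff.2 ⟨p⟩
  rw [← Finset.add_sum_erase _ _ (Finset.mem_univ p),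
    Finset.sum_congr rfl (fun q hq => h.sum_blocks_mul (Finset.ne_of_mem_erase hq).symm)] at h1
  simp only [pointBlockMatrix_mul_self, Finset.sum_const, Finset.card_erase_of_mem,
    Finset.mem_univ, Finset.card_univ, nsmul_eq_mul, h.card_points, Nat.cast_sub hP,
    Nat.cast_one] at h1
  have hk' : (k : ℝ) - 1 ≠ 0 := by linarith
  rw [eq_div_iff hk']
  linear_combination -h1

theorem pointBlockMatrix_mul_transpose [DecidableEq P] (h : IsTwoDesign I v b k l) {r : ℝ}
    (hr : r = (l : ℝ) * ((v : ℝ) - 1) / ((k : ℝ) - 1)) :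
    pointBlockMatrix I * (pointBlockMatrix I)ᵀ =
      (r - l) • (1 : Matrix P P ℝ) + (l : ℝ) • onesMatrix P P := by
  ext p q
  simp only [mul_apply, transpose_apply, Matrix.add_apply, Matrix.smul_apply, onesMatrix, of_apply,
    smul_eq_mul]
  by_cases hpq : p = q
  · subst hpq
    simp only [pointBlockMatrix_mul_self, h.sum_blocks, one_apply_eq, hr]
    ring
  · rw [h.sum_blocks_mul hpq, one_apply_ne hpq]
    ring

theorem pointBlockMatrix_mul_ones (h : IsTwoDesign I v b k l) {r : ℝ}
    (hr : r = (l : ℝ) * ((v : ℝ) - 1) / ((k : ℝ) - 1)) :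
    pointBlockMatrix I * onesMatrix B B = r • onesMatrix P B := by
  ext p β
  simp [mul_apply, onesMatrix, h.sum_blocks, hr]

theorem ones_mul_pointBlockMatrix (h : IsTwoDesign I v b k l) (m : Type*) :
    onesMatrix m P * pointBlockMatrix I = (k : ℝ) • onesMatrix m B := by
  ext p β
  simp [mul_apply, onesMatrix, h.sum_points]

theorem pointBlockMatrix_transpose_mul_ones (h : IsTwoDesign I v b k l) (m : Type*) :
    (pointBlockMatrix I)ᵀ * onesMatrix P m = (k : ℝ) • onesMatrix B m := by
  ext p β
  simp [mul_apply, onesMatrix, h.sum_points]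

end IsTwoDesign

namespace IsQuasiSymmetricDesign

variable {I} [Fintype P] [Fintype B] {v b k l x y : ℕ}

theorem cast_sub_ne_zero (h : IsQuasiSymmetricDesign I v b k l x y) : (y : ℝ) - x ≠ 0 :=
  sub_ne_zero.2 (Nat.cast_injective.ne h.x_ne_y.symm)

/-- If k = v, every block contains all points and only one intersection size occurs. Strictness
provides a non-incident point-block pair. -/
theorem k_lt_v (h : IsQuasiSymmetricDesign I v b k l x y) : k < v := by
  refine lt_of_le_of_ne h.k_le_v fun hkv => h.x_ne_y ?_
  have hall : ∀ p β, I p β := fun p β => by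
    have := h.block_size β
    rw [hkv, ← h.card_points, Finset.card_eq_iff_eq_univ, Finset.ext_iff] at this
    simpa using this p
  obtain ⟨_, _, -, hx⟩ := h.exists_x
  obtain ⟨_, _, -, hy⟩ := h.exists_y
  rw [← hx, ← hy]
  simp [blockIntersectionSize, hall]

variable [DecidableEq B]

theorem transpose_mul_pointBlockMatrix (h : IsQuasiSymmetricDesign I v b k l x y) :
    (pointBlockMatrix I)ᵀ * pointBlockMatrix I =
      ((k : ℝ) - x) • (1 : Matrix B B ℝ) + ((y : ℝ) - x) • blockGraphMatrix I y +
        (x : ℝ) • onesMatrix B B := by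
  ext β γ
  simp only [mul_apply, transpose_apply, Matrix.add_apply, Matrix.smul_apply, onesMatrix, of_apply,
    smul_eq_mul, blockGraphMatrix]
  by_cases hβγ : β = γ
  · subst hβγ
    simp [pointBlockMatrix_mul_self, h.sum_points]
  · have hsum : ∑ p, pointBlockMatrix I p β * pointBlockMatrix I p γ =
        (blockIntersectionSize I β γ : ℝ) := by
      simp [pointBlockMatrix_apply, ← ite_and, Finset.sum_boole, blockIntersectionSize, and_comm]
    rw [hsum, one_apply_ne hβγ]
    rcases h.intersection β γ hβγ with hs | hs
    · simp [hs, h.x_ne_y]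
    · simp [hs, hβγ]

theorem blockGraphMatrix_eq (h : IsQuasiSymmetricDesign I v b k l x y) :
    ((y : ℝ) - x) • blockGraphMatrix I y = (pointBlockMatrix I)ᵀ * pointBlockMatrix I -
      ((k : ℝ) - x) • (1 : Matrix B B ℝ) - (x : ℝ) • onesMatrix B B := by
  rw [h.transpose_mul_pointBlockMatrix]
  abel

variable {r a ρ₁ ρ₂ : ℝ}

/-- Multiply (y - x)A = NᵀN - (k - x)I - xJ by N on the left and use NNᵀ = (r - l)I + lJ. -/
theorem pointBlockMatrix_mul_blockGraphMatrix (h : IsQuasiSymmetricDesign I v b k l x y)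
    (hr : r = (l : ℝ) * ((v : ℝ) - 1) / ((k : ℝ) - 1))
    (hρ₁ : ρ₁ = (r - (l : ℝ) - (k : ℝ) + (x : ℝ)) / ((y : ℝ) - (x : ℝ))) :
    pointBlockMatrix I * blockGraphMatrix I y =
      ρ₁ • pointBlockMatrix I + (((l : ℝ) * k - x * r) / ((y : ℝ) - x)) • onesMatrix P B := by
  classical
  have hyx := h.cast_sub_ne_zero
  refine smul_right_injective _ hyx ?_
  change ((y : ℝ) - x) • _ = ((y : ℝ) - x) • _
  rw [← Matrix.mul_smul, h.blockGraphMatrix_eq, Matrix.mul_sub, Matrix.mul_sub, ← Matrix.mul_assoc,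
    h.pointBlockMatrix_mul_transpose hr, Matrix.add_mul, Matrix.smul_mul, Matrix.one_mul,
    Matrix.smul_mul, h.ones_mul_pointBlockMatrix, Matrix.mul_smul, Matrix.mul_one, Matrix.mul_smul,
    h.pointBlockMatrix_mul_ones hr, smul_add, smul_smul, smul_smul, smul_smul, smul_smul, hρ₁,
    mul_div_cancel₀ _ hyx, mul_div_cancel₀ _ hyx]
  module

theorem blockGraphMatrix_mul_ones (h : IsQuasiSymmetricDesign I v b k l x y)
    (hr : r = (l : ℝ) * ((v : ℝ) - 1) / ((k : ℝ) - 1))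
    (ha : a = ((r - 1) * (k : ℝ) - (x : ℝ) * ((b : ℝ) - 1)) / ((y : ℝ) - (x : ℝ))) :
    blockGraphMatrix I y * onesMatrix B B = a • onesMatrix B B := by
  have hyx := h.cast_sub_ne_zero
  refine smul_right_injective _ hyx ?_
  change ((y : ℝ) - x) • _ = ((y : ℝ) - x) • _
  rw [← Matrix.smul_mul, h.blockGraphMatrix_eq, Matrix.sub_mul, Matrix.sub_mul, Matrix.mul_assoc,
    h.pointBlockMatrix_mul_ones hr, Matrix.mul_smul, h.pointBlockMatrix_transpose_mul_ones,
    Matrix.smul_mul, Matrix.one_mul, Matrix.smul_mul, onesMatrix_mul_onesMatrix, h.card_blocks,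
    smul_smul, smul_smul, smul_smul, ha, mul_div_cancel₀ _ hyx]
  module

theorem sum_blockGraphMatrix (h : IsQuasiSymmetricDesign I v b k l x y)
    (hr : r = (l : ℝ) * ((v : ℝ) - 1) / ((k : ℝ) - 1))
    (ha : a = ((r - 1) * (k : ℝ) - (x : ℝ) * ((b : ℝ) - 1)) / ((y : ℝ) - (x : ℝ))) (β : B) :
    ∑ γ, blockGraphMatrix I y β γ = a := by
  have := congrFun (congrFun (h.blockGraphMatrix_mul_ones hr ha) β) β
  simpa [mul_apply, onesMatrix] using this

/-- The block graph of a quasi-symmetric design is strongly regular. -/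
theorem blockGraphMatrix_mul_self (h : IsQuasiSymmetricDesign I v b k l x y)
    (hr : r = (l : ℝ) * ((v : ℝ) - 1) / ((k : ℝ) - 1))
    (ha : a = ((r - 1) * (k : ℝ) - (x : ℝ) * ((b : ℝ) - 1)) / ((y : ℝ) - (x : ℝ)))
    (hρ₁ : ρ₁ = (r - (l : ℝ) - (k : ℝ) + (x : ℝ)) / ((y : ℝ) - (x : ℝ)))
    (hρ₂ : ρ₂ = ((x : ℝ) - (k : ℝ)) / ((y : ℝ) - (x : ℝ))) :
    blockGraphMatrix I y * blockGraphMatrix I y =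
      (ρ₁ + ρ₂) • blockGraphMatrix I y - (ρ₁ * ρ₂) • (1 : Matrix B B ℝ) +
        (a + ρ₁ * ρ₂) • onesMatrix B B := by
  have hyx := h.cast_sub_ne_zero
  have hJA : onesMatrix B B * blockGraphMatrix I y = a • onesMatrix B B := by
    have := congrArg transpose (h.blockGraphMatrix_mul_ones hr ha)
    rwa [transpose_mul, transpose_smul, onesMatrix_transpose, blockGraphMatrix_transpose] at this
  obtain ⟨s, hs⟩ : ∃ s : ℝ, blockGraphMatrix I y * blockGraphMatrix I y =
      (ρ₁ + ρ₂) • blockGraphMatrix I y - (ρ₁ * ρ₂) • (1 : Matrix B B ℝ) + s • onesMatrix B B := by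
    -- The coefficient of J on expanding (y - x)A² = Nᵀ(NA) - (k - x)A - xJA.
    refine ⟨(ρ₁ * x + ((l : ℝ) * k - x * r) / ((y : ℝ) - x) * k - x * a) / ((y : ℝ) - x), ?_⟩
    have hk : (k : ℝ) - x = -(((y : ℝ) - x) * ρ₂) := by
      rw [hρ₂, mul_div_cancel₀ _ hyx]; ring
    refine smul_right_injective _ hyx ?_
    change ((y : ℝ) - x) • _ = ((y : ℝ) - x) • _
    rw [← Matrix.smul_mul, h.blockGraphMatrix_eq, Matrix.sub_mul, Matrix.sub_mul, Matrix.mul_assoc,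
      h.pointBlockMatrix_mul_blockGraphMatrix hr hρ₁, Matrix.mul_add, Matrix.mul_smul,
      Matrix.mul_smul, h.pointBlockMatrix_transpose_mul_ones, h.transpose_mul_pointBlockMatrix,
      Matrix.smul_mul, Matrix.one_mul, Matrix.smul_mul, hJA, hk, smul_add ((y : ℝ) - x),
      smul_smul ((y : ℝ) - x) _ (onesMatrix B B), mul_div_cancel₀ _ hyx]
    module
  rw [hs]
  congr 1
  ext β γ
  have hβ := congrFun (congrFun hs β) β
  -- The coefficient of J simplifies by comparing diagonals: A is a symmetric 0-1 matrix with row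
  -- sums `a`, so A² has diagonal `a`.
  have hdiag : (blockGraphMatrix I y * blockGraphMatrix I y) β β = a := by
    rw [← h.sum_blockGraphMatrix hr ha β, mul_apply]
    refine Finset.sum_congr rfl fun γ _ => ?_
    rw [← congrFun (congrFun (blockGraphMatrix_transpose I y) γ) β, transpose_apply]
    simp only [blockGraphMatrix, of_apply]
    split_ifs <;> simp
  rw [hdiag] at hβ
  simp [onesMatrix, blockGraphMatrix] at hβ
  simp [onesMatrix]
  linarith

end IsQuasiSymmetricDesign

end Design

/-! ### Block decomposition of the adjacency matrix -/

namespace SimpleGraph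

variable {V : Type*} {G : SimpleGraph V} [DecidableRel G.Adj]
  {V₁ V₂ : Finset V}

theorem IsBiregularWithValencyPartition.disjoint [Fintype V]
    (h : G.IsBiregularWithValencyPartition V₁ V₂) : Disjoint V₁ V₂ := by
  obtain ⟨k₁, k₂, hne, -, -, h₁, h₂, -⟩ := h
  exact Finset.disjoint_left.2 fun u hu hu' => hne (((h₁ u).1 hu).symm.trans ((h₂ u).1 hu'))

theorem IsBiregularWithValencyPartition.sum_eq [Fintype V]
    (h : G.IsBiregularWithValencyPartition V₁ V₂) (f : V → ℝ) :
    ∑ z, f z = ∑ p : V₁, f p + ∑ β : V₂, f β := by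
  classical
  have hcover : V₁ ∪ V₂ = Finset.univ := by
    obtain ⟨k₁, k₂, -, -, -, -, -, h⟩ := h
    ext u
    simpa using h u
  rw [Finset.sum_coe_sort V₁ f, Finset.sum_coe_sort V₂ f, ← hcover,
    Finset.sum_union h.disjoint]

theorem adjMatrix_point_point [DecidableEq V] (hcomplete : G.IsClique (V₁ : Set V)) (p q : V₁) :
    G.adjMatrix ℝ p q = 1 - (1 : Matrix V₁ V₁ ℝ) p q := by
  by_cases hpq : p = q
  · subst hpq
    simp
  · have : G.Adj p q := hcomplete p.2 q.2 (Subtype.coe_injective.ne hpq)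
    simp [hpq, this]

theorem adjMatrix_point_block (p : V₁) (β : V₂) :
    G.adjMatrix ℝ p β = pointBlockMatrix (G.incidenceBetween V₁ V₂) p β := rfl

theorem adjMatrix_block_point (p : V₁) (β : V₂) :
    G.adjMatrix ℝ β p = pointBlockMatrix (G.incidenceBetween V₁ V₂) p β := by
  rw [← adjMatrix_point_block, (G.isSymm_adjMatrix (α := ℝ)).apply]

theorem adj_block_block_iff {y : ℕ}
    (hblock : G.comap (Subtype.val : V₂ → V) = blockGraph (G.incidenceBetween V₁ V₂) y)
    (β γ : V₂) :
    G.Adj β γ ↔ β ≠ γ ∧ blockIntersectionSize (G.incidenceBetween V₁ V₂) β γ = y := by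
  have : (G.comap (Subtype.val : V₂ → V)).Adj β γ ↔
      (blockGraph (G.incidenceBetween V₁ V₂) y).Adj β γ := by rw [hblock]
  exact this

theorem adjMatrix_block_block [DecidableEq V] {y : ℕ}
    (hblock : G.comap (Subtype.val : V₂ → V) = blockGraph (G.incidenceBetween V₁ V₂) y)
    (β γ : V₂) :
    G.adjMatrix ℝ β γ = blockGraphMatrix (G.incidenceBetween V₁ V₂) y β γ := by
  simp only [adjMatrix_apply, blockGraphMatrix, of_apply, adj_block_block_iff hblock]

theorem degree_eq_sum_adjMatrix [Fintype V] (u : V) : (G.degree u : ℝ) = ∑ z, G.adjMatrix ℝ u z := by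
  rw [G.degree_eq_sum_if_adj (R := ℝ)]
  simp only [adjMatrix_apply]

end SimpleGraph

namespace IsQuasiSymmetricDesign

variable {P B : Type*} {I : P → B → Prop} [∀ p β, Decidable (I p β)] [Fintype P] [Fintype B]
  {v b k l x y : ℕ}

theorem exists_incident (h : IsQuasiSymmetricDesign I v b k l x y) (β : B) : ∃ p, I p β := by
  have hpos : 0 < (Finset.univ.filter fun p : P => I p β).card := by
    rw [h.block_size β]
    have := h.two_le_k
    omega
  obtain ⟨p, hp⟩ := Finset.card_pos.1 hpos
  exact ⟨p, by simpa using hp⟩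

theorem exists_not_incident (h : IsQuasiSymmetricDesign I v b k l x y) (β : B) :
    ∃ p, ¬ I p β := by
  by_contra! hall
  have := h.block_size β
  rw [Finset.filter_true_of_mem fun p _ => hall p, Finset.card_univ, h.card_points] at this
  exact h.k_lt_v.ne this.symm

theorem exists_point_ne (h : IsQuasiSymmetricDesign I v b k l x y) (p : P) : ∃ q, p ≠ q := by
  have : 1 < Fintype.card P := by
    have := h.two_le_k
    have := h.k_le_v
    have := h.card_points
    omega
  obtain ⟨q, hq⟩ := Fintype.exists_ne_of_one_lt_card this p
  exact ⟨q, hq.symm⟩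

end IsQuasiSymmetricDesign

/-! ### The seven equations -/

theorem proposition5p4 {V : Type*} [Fintype V] [DecidableEq V]
    (G : SimpleGraph V) [DecidableRel G.Adj] (V₁ V₂ : Finset V)
    (v b k l x y : ℕ) (r a c d ρ₁ ρ₂ θ₁ θ₂ t : ℝ)
    (hbireg : G.IsBiregularWithValencyPartition V₁ V₂)
    (hcomplete : G.IsClique (V₁ : Set V))
    (hdesign : IsQuasiSymmetricDesign (G.incidenceBetween V₁ V₂) v b k l x y)
    (hblock : G.comap (Subtype.val : V₂ → V) = blockGraph (G.incidenceBetween V₁ V₂) y)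
    (hr : r = (l : ℝ) * ((v : ℝ) - 1) / ((k : ℝ) - 1))
    (ha : a = ((r - 1) * (k : ℝ) - (x : ℝ) * ((b : ℝ) - 1)) / ((y : ℝ) - (x : ℝ)))
    (hρ₁ : ρ₁ = (r - (l : ℝ) - (k : ℝ) + (x : ℝ)) / ((y : ℝ) - (x : ℝ)))
    (hρ₂ : ρ₂ = ((x : ℝ) - (k : ℝ)) / ((y : ℝ) - (x : ℝ)))
    (hd : d = a + ρ₁ * ρ₂)
    (hc : c = d + ρ₁ + ρ₂)
    (ht : t = θ₁ * θ₂ / ((v : ℝ) * ((v : ℝ) - 1 + r) + (b : ℝ) * ((k : ℝ) + a))) :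
    G.HasThreeNormalizedLaplacianEigenvalues θ₁ θ₂ ↔
      (((v : ℝ) - 1) / ((v : ℝ) - 1 + r) + r / ((k : ℝ) + a)
          = t * ((v : ℝ) - 1 + r) ^ 2 - (θ₁ - 1) * (θ₂ - 1) * ((v : ℝ) - 1 + r) ∧
        ((v : ℝ) - 2) / ((v : ℝ) - 1 + r) + (l : ℝ) / ((k : ℝ) + a)
          = t * ((v : ℝ) - 1 + r) ^ 2 + 2 - θ₁ - θ₂ ∧
        (k : ℝ) / ((v : ℝ) - 1 + r) + a / ((k : ℝ) + a)
          = t * ((k : ℝ) + a) ^ 2 - (θ₁ - 1) * (θ₂ - 1) * ((k : ℝ) + a) ∧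
        (x : ℝ) / ((v : ℝ) - 1 + r) + d / ((k : ℝ) + a)
          = t * ((k : ℝ) + a) ^ 2 ∧
        (y : ℝ) / ((v : ℝ) - 1 + r) + c / ((k : ℝ) + a)
          = t * ((k : ℝ) + a) ^ 2 + 2 - θ₁ - θ₂ ∧
        (k : ℝ) / ((v : ℝ) - 1 + r)
            + ((l : ℝ) * (k : ℝ) - (x : ℝ) * r) / (((y : ℝ) - (x : ℝ)) * ((k : ℝ) + a))
          = t * ((v : ℝ) - 1 + r) * ((k : ℝ) + a) ∧
        ((k : ℝ) - 1) / ((v : ℝ) - 1 + r)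
            + (((l : ℝ) - 1) * ((k : ℝ) - 1) - ((x : ℝ) - 1) * (r - 1))
              / (((y : ℝ) - (x : ℝ)) * ((k : ℝ) + a))
          = t * ((v : ℝ) - 1 + r) * ((k : ℝ) + a) + 2 - θ₁ - θ₂) := by
  have hpart : ∀ u, u ∈ V₁ ∨ u ∈ V₂ := by
    obtain ⟨_, _, -, -, -, -, -, h⟩ := hbireg
    exact h
  have hdeg : ∀ u, 0 < G.degree u := by
    intro u
    rw [G.degree_pos_iff_exists_adj]
    rcases hpart u with hu | hu
    · obtain ⟨q, hq⟩ := hdesign.exists_point_ne ⟨u, hu⟩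
      exact ⟨q, hcomplete hu q.2 fun h => hq (Subtype.ext h)⟩
    · obtain ⟨p, hp⟩ := hdesign.exists_incident ⟨u, hu⟩
      exact ⟨p, hp.symm⟩
  -- These points and blocks represent all seven types of pairs; the non-adjacent pair β₀, γ₀ also
  -- shows that the graph is not complete.
  obtain ⟨β₀, γ₀, hβγ₀, hx₀⟩ := hdesign.exists_x
  obtain ⟨β₁, γ₁, hβγ₁, hy₁⟩ := hdesign.exists_y
  obtain ⟨p₀, hp₀⟩ := hdesign.exists_incident β₀
  obtain ⟨p₁, hp₁⟩ := hdesign.exists_not_incident β₀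
  obtain ⟨q₀, hq₀⟩ := hdesign.exists_point_ne p₀
  have hconn : G.Connected := by
    have hreach : ∀ u, G.Reachable (p₀ : V) u := by
      have hpt : ∀ p : V₁, G.Reachable (p₀ : V) p := fun p => by
        by_cases h : p₀ = p
        · rw [h]
        · exact (hcomplete p₀.2 p.2 (Subtype.coe_injective.ne h)).reachable
      intro u
      rcases hpart u with hu | hu
      · exact hpt ⟨u, hu⟩
      · obtain ⟨p, hp⟩ := hdesign.exists_incident ⟨u, hu⟩
        exact (hpt p).trans (SimpleGraph.Adj.reachable hp)
    have : Nonempty V := ⟨p₀⟩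
    exact ⟨fun u w => (hreach u).symm.trans (hreach w)⟩
  have hadj₀ : ¬ G.Adj β₀ γ₀ := fun h =>
    hdesign.x_ne_y (hx₀.symm.trans ((SimpleGraph.adj_block_block_iff hblock β₀ γ₀).1 h).2)
  have hadj₁ : G.Adj β₁ γ₁ := (SimpleGraph.adj_block_block_iff hblock β₁ γ₁).2 ⟨hβγ₁, hy₁⟩
  have hnc : ∃ u w, u ≠ w ∧ ¬ G.Adj u w := ⟨β₀, γ₀, Subtype.coe_injective.ne hβγ₀, hadj₀⟩
  have hPP := SimpleGraph.adjMatrix_point_point hcomplete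
  have hPB := SimpleGraph.adjMatrix_point_block (G := G) (V₁ := V₁) (V₂ := V₂)
  have hBP := SimpleGraph.adjMatrix_block_point (G := G) (V₁ := V₁) (V₂ := V₂)
  have hBB := SimpleGraph.adjMatrix_block_block hblock
  have hV₁ : V₁.card = v := by rw [← hdesign.card_points, Fintype.card_coe]
  have hcardP : (Fintype.card V₁ : ℝ) = v := by exact_mod_cast hdesign.card_points
  have hcardB : (Fintype.card V₂ : ℝ) = b := by exact_mod_cast hdesign.card_blocks
  have hdegP : ∀ p : V₁, (G.degree p : ℝ) = v - 1 + r := fun p => by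
    rw [SimpleGraph.degree_eq_sum_adjMatrix, hbireg.sum_eq]
    simp only [hPP, hPB, hdesign.sum_blocks, Finset.sum_sub_distrib, ← hr]
    simp [Matrix.one_apply, hV₁]
  have hdegB : ∀ β : V₂, (G.degree β : ℝ) = k + a := fun β => by
    rw [SimpleGraph.degree_eq_sum_adjMatrix, hbireg.sum_eq]
    simp only [hBP, hBB, hdesign.sum_points, hdesign.sum_blockGraphMatrix hr ha]
  have hsumdeg : ∑ u, (G.degree u : ℝ) = v * (v - 1 + r) + b * (k + a) := by
    rw [hbireg.sum_eq]
    simp only [hdegP, hdegB, Finset.sum_const, Finset.card_univ, nsmul_eq_mul, hcardP, hcardB]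
  have hcn : ∀ u w, ∑ z, G.adjMatrix ℝ u z * G.adjMatrix ℝ z w / (G.degree z : ℝ) =
      (∑ p : V₁, G.adjMatrix ℝ u p * G.adjMatrix ℝ p w) / (v - 1 + r) +
        (∑ β : V₂, G.adjMatrix ℝ u β * G.adjMatrix ℝ β w) / (k + a) := fun u w => by
    rw [hbireg.sum_eq]
    simp only [hdegP, hdegB, Finset.sum_div]
  have hcnPP : ∀ p q : V₁, ∑ z, G.adjMatrix ℝ p z * G.adjMatrix ℝ z q / (G.degree z : ℝ) =
      (v - 2 + (1 : Matrix V₁ V₁ ℝ) p q) / (v - 1 + r) +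
        ((r - l) * (1 : Matrix V₁ V₁ ℝ) p q + l) / (k + a) := fun p q => by
    have h1 := congrFun (congrFun (hdesign.pointBlockMatrix_mul_transpose hr) p) q
    simp only [mul_apply, transpose_apply, Matrix.add_apply, Matrix.smul_apply, onesMatrix,
      of_apply, smul_eq_mul, mul_one] at h1
    -- Entrywise, (J - I)² = (v - 2)J + I.
    have h2 : ∑ z : V₁, (1 - (1 : Matrix V₁ V₁ ℝ) p z) * (1 - (1 : Matrix V₁ V₁ ℝ) z q) =
        v - 2 + (1 : Matrix V₁ V₁ ℝ) p q := by
      have h3 : ∑ z : V₁, (1 : Matrix V₁ V₁ ℝ) p z * (1 : Matrix V₁ V₁ ℝ) z q =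
          (1 : Matrix V₁ V₁ ℝ) p q := by rw [← mul_apply, Matrix.one_mul]
      simp only [sub_mul, one_mul, mul_sub, mul_one, Finset.sum_sub_distrib, h3]
      simp [Matrix.one_apply, hV₁]
      ring
    rw [hcn]
    simp only [hPP, hPB, hBP, h1, h2]
  have hcnPB : ∀ (p : V₁) (β : V₂),
      ∑ z, G.adjMatrix ℝ p z * G.adjMatrix ℝ z β / (G.degree z : ℝ) =
      (k - pointBlockMatrix (G.incidenceBetween V₁ V₂) p β) / (v - 1 + r) +
        (ρ₁ * pointBlockMatrix (G.incidenceBetween V₁ V₂) p β + (l * k - x * r) / (y - x)) /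
          (k + a) := fun p β => by
    have h1 := congrFun (congrFun (hdesign.pointBlockMatrix_mul_blockGraphMatrix hr hρ₁) p) β
    simp only [mul_apply, Matrix.add_apply, Matrix.smul_apply, onesMatrix,
      of_apply, smul_eq_mul, mul_one] at h1
    rw [hcn]
    simp only [hPP, hPB, hBB, h1, sub_mul, one_mul, Finset.sum_sub_distrib, hdesign.sum_points]
    rw [← mul_apply, Matrix.one_mul]
  have hcnBB : ∀ β γ : V₂, ∑ z, G.adjMatrix ℝ β z * G.adjMatrix ℝ z γ / (G.degree z : ℝ) =
      ((k - x) * (1 : Matrix V₂ V₂ ℝ) β γ + (y - x) * G.adjMatrix ℝ β γ + x) / (v - 1 + r) +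
        ((ρ₁ + ρ₂) * G.adjMatrix ℝ β γ - ρ₁ * ρ₂ * (1 : Matrix V₂ V₂ ℝ) β γ + d) / (k + a) :=
    fun β γ => by
    have h1 := congrFun (congrFun hdesign.transpose_mul_pointBlockMatrix β) γ
    have h2 := congrFun (congrFun (hdesign.blockGraphMatrix_mul_self hr ha hρ₁ hρ₂) β) γ
    simp only [mul_apply, transpose_apply, Matrix.add_apply, Matrix.sub_apply, Matrix.smul_apply,
      onesMatrix, of_apply, smul_eq_mul, mul_one] at h1 h2
    rw [hcn]
    simp only [hPB, hBP, hBB, h1, h2, hd]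
  have hsymm : ∀ u w, ∑ z, G.adjMatrix ℝ u z * G.adjMatrix ℝ z w / (G.degree z : ℝ) =
      ∑ z, G.adjMatrix ℝ w z * G.adjMatrix ℝ z u / (G.degree z : ℝ) := fun u w =>
    Finset.sum_congr rfl fun z _ => by
      rw [(G.isSymm_adjMatrix (α := ℝ)).apply z u, (G.isSymm_adjMatrix (α := ℝ)).apply w z,
        mul_comm]
  have hyx := hdesign.cast_sub_ne_zero
  -- The numerator in the last equation is y - x times the entry of NA at an incident pair, the
  -- entry at a non-incident pair plus ρ₁.
  have he : ((l : ℝ) - 1) * (k - 1) - (x - 1) * (r - 1) =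
      (y - x) * (ρ₁ + (l * k - x * r) / (y - x)) := by
    rw [hρ₁]
    field_simp
    ring
  have hPBne : ∀ (p : V₁) (β : V₂), (p : V) ≠ β := fun p β h =>
    Finset.disjoint_left.1 hbireg.disjoint p.2 (h ▸ β.2)
  rw [G.hasThreeNormalizedLaplacianEigenvalues_iff hdeg hconn hnc, hsumdeg, ← ht, he,
    mul_div_mul_left _ _ hyx, ← div_div]
  constructor
  · intro h
    refine ⟨?_, ?_, ?_, ?_, ?_, ?_, ?_⟩
    · have := h p₀ p₀
      rw [hcnPP] at this
      simp only [hdegP, one_apply_eq, if_true, SimpleGraph.adjMatrix_apply, SimpleGraph.irrefl,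
        if_false] at this
      linear_combination this
    · have := h p₀ q₀
      rw [hcnPP, hPP, one_apply_ne hq₀, if_neg (Subtype.coe_injective.ne hq₀), hdegP, hdegP] at this
      linear_combination this
    · have := h β₀ β₀
      rw [hcnBB] at this
      simp only [hdegB, one_apply_eq, if_true, SimpleGraph.adjMatrix_apply, SimpleGraph.irrefl,
        if_false, hd] at this
      linear_combination this
    · have := h β₀ γ₀
      rw [hcnBB, SimpleGraph.adjMatrix_apply, if_neg hadj₀, one_apply_ne hβγ₀,
        if_neg (Subtype.coe_injective.ne hβγ₀), hdegB, hdegB] at this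
      linear_combination this
    · have := h β₁ γ₁
      rw [hcnBB, SimpleGraph.adjMatrix_apply, if_pos hadj₁, one_apply_ne hβγ₁,
        if_neg (Subtype.coe_injective.ne hβγ₁), hdegB, hdegB] at this
      rw [hc]
      linear_combination this
    · have := h p₁ β₀
      rw [hcnPB, hPB, if_neg (hPBne _ _), hdegB, hdegP, pointBlockMatrix_apply, if_neg hp₁] at this
      linear_combination this
    · have := h p₀ β₀
      rw [hcnPB, hPB, if_neg (hPBne _ _), hdegB, hdegP, pointBlockMatrix_apply, if_pos hp₀] at this
      linear_combination this
  · rintro ⟨h1, h2, h3, h4, h5, h6, h7⟩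
    have hPBeq : ∀ (p : V₁) (β : V₂),
        ∑ z, G.adjMatrix ℝ p z * G.adjMatrix ℝ z β / (G.degree z : ℝ) =
          t * G.degree p * G.degree β + (2 - θ₁ - θ₂) * G.adjMatrix ℝ p β := fun p β => by
      rw [hcnPB, hPB, hdegB, hdegP, pointBlockMatrix_apply]
      split_ifs
      · linear_combination h7
      · linear_combination h6
    intro u w
    rcases hpart u with hu | hu <;> rcases hpart w with hw | hw
    · lift u to V₁ using hu
      lift w to V₁ using hw
      by_cases huw : u = w
      · subst huw
        rw [hcnPP]
        simp only [hdegP, one_apply_eq, if_true, SimpleGraph.adjMatrix_apply, SimpleGraph.irrefl,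
          if_false]
        linear_combination h1
      · rw [hcnPP, hPP, one_apply_ne huw, if_neg (Subtype.coe_injective.ne huw), hdegP, hdegP]
        linear_combination h2
    · lift u to V₁ using hu
      lift w to V₂ using hw
      rw [hPBeq, if_neg (hPBne _ _)]
      ring
    · lift u to V₂ using hu
      lift w to V₁ using hw
      -- The block-point equation is the transpose of the point-block one.
      rw [hsymm, hPBeq, if_neg (hPBne _ _).symm, (G.isSymm_adjMatrix (α := ℝ)).apply]
      ring
    · lift u to V₂ using hu
      lift w to V₂ using hw
      by_cases huw : u = w
      · subst huw
        rw [hcnBB]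
        simp only [hdegB, one_apply_eq, if_true, SimpleGraph.adjMatrix_apply, SimpleGraph.irrefl,
          if_false, hd]
        linear_combination h3
      · rw [hcnBB, SimpleGraph.adjMatrix_apply, one_apply_ne huw,
          if_neg (Subtype.coe_injective.ne huw), hdegB, hdegB]
        split_ifs
        · rw [hc] at h5
          linear_combination h5
        · linear_combination h4
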